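/- Let $G$ be a $\sigma$-compact Hausdorff locally compact abelian group with identity $0$ and a fixed Haar measure $\lambda_G$. A function $f:G\to\mathbb{R}$ is positive definite if $\sum_{i,j=1}^{n} c_i\overline{c_j}\,f(g_i-g_j)\ge 0$ for all $n\in\mathbb{N}$, $c_1,\dots,c_n\in\mathbb{C}$ and $g_1,\dots,g_n\in G$. For $\Omega_+,\Omega_-\subseteq G$, let $\mathcal{F}_G(\Omega_+,\Omega_-)$ be the set of continuous, $\lambda_G$-integrable, positive definite functions $f:G\to\mathbb{R}$ with $f(0)=1$, $\{x: f(x)>0\}\subseteq\Omega_+$ and $\{x: f(x)<0\}\subseteq\Omega_-$, and let $$\mathcal{C}_G(\Omega_+,\Omega_-):=\sup_{f\in\mathcal{F}_G(\Omega_+,\Omega_-)}\int_G f\,d\lambda_G$$ (with the value $0$ if $\mathcal{F}_G(\Omega_+,\Omega_-)$ is empty). A subset $\Omega$ of a topological space is called boundary-coherent if its boundary $\partial\Omega$ is contained in the closure of its exterior, where the exterior is the complement of $\overline{\Omega}$. Theorem. Suppose that $\Omega_+$ and $\Omega_-$ are boundary-coherent symmetric subsets of $G$ (that is, $-\Omega_\pm=\Omega_\pm$)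 and that $\Omega_+$ is a neighbourhood of $0$ of finite Haar measure. Then there exists $f\in\mathcal{F}_G(\Omega_+,\Omega_-)$ with $\int_G f\,d\lambda_G=\mathcal{C}_G(\Omega_+,\Omega_-)$. -/

import Mathlib

open MeasureTheory
open scoped Topology Pointwise ComplexOrder

/-- A real-valued function `f` on an abelian group is positive definite if
`∑ i, ∑ j, c i * conj (c j) * f (g i - g j) ≥ 0` for all finite families of complex numbers `c`
and group elements `g`. (In the order of `ℂ`, `0 ≤ z` says that `z` is real and non-negative.) -/
def PositiveDefinite {G : Type*} [AddCommGroup G] (f : G → ℝ) : Prop :=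
  ∀ (n : ℕ) (c : Fin n → ℂ) (g : Fin n → G),
    0 ≤ ∑ i, ∑ j, c i * (starRingEnd ℂ) (c j) * (f (g i - g j) : ℂ)

/-- A subset of a topological space is boundary-coherent if its boundary is contained in the
closure of its exterior, the exterior being the complement of the closure. -/
def BoundaryCoherent {X : Type*} [TopologicalSpace X] (Ω : Set X) : Prop :=
  frontier Ω ⊆ closure (closure Ω)ᶜ

/-- The class `P₁(G)` of continuous positive definite functions `f : G → ℝ` with `f 0 = 1`. -/
def normalizedPositiveDefinite (G : Type*) [AddCommGroup G] [TopologicalSpace G] :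
    Set (G → ℝ) :=
  {f | Continuous f ∧ PositiveDefinite f ∧ f 0 = 1}

/-- The class `𝓕_G(Ω₊, Ω₋)` of integrable functions in `P₁(G)` that are positive only on `Ω₊` and
negative only on `Ω₋`. -/
def admissibleClass {G : Type*} [AddCommGroup G] [TopologicalSpace G] [MeasurableSpace G]
    (μ : Measure G) (Ωp Ωm : Set G) : Set (G → ℝ) :=
  {f | f ∈ normalizedPositiveDefinite G ∧ Integrable f μ ∧
    f ⁻¹' Set.Ioi 0 ⊆ Ωp ∧ f ⁻¹' Set.Iio 0 ⊆ Ωm}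

open Classical in
/-- The extremal value `𝓒_G(Ω₊, Ω₋)`: the supremum, in the extended reals, of the integrals of the
functions in `𝓕_G(Ω₊, Ω₋)`, with the convention that it is `0` if this class is empty. -/
noncomputable def extremalValue {G : Type*} [AddCommGroup G] [TopologicalSpace G]
    [MeasurableSpace G] (μ : Measure G) (Ωp Ωm : Set G) : EReal :=
  if (admissibleClass μ Ωp Ωm).Nonempty then
    ⨆ f ∈ admissibleClass μ Ωp Ωm, ((∫ x, f x ∂μ : ℝ) : EReal)
  else 0

/-! The direct method, run with strong rather than weak convergence. Admissible functions with
integral near the supremum C form decreasing convex sets, bounded in L². Their closures share a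
point u, so some maximizing sequence converges to u in L² (`exists_maximizing_seq_tendsto_Lp`).

The main difficulty is a continuous representative of u, since L² convergence does not give
equicontinuity at 0. Among continuous positive definite L²-approximants g of u, take near-minimizers
of g 0. Averaging g over small translations gives another approximant, with value (g 0 + g x) / 2 at
0, so near-minimality forces g x to be close to g 0. Krein's inequality spreads this to all points,
and equicontinuity turns L² convergence into uniform convergence
(`exists_continuous_positiveDefinite_ae_eq`).

The limit h has h 0 ≤ 1. Reverse Fatou keeps its integral at least C, boundary-coherence turns
almost everywhere sign conditions into pointwise ones, and dividing by h 0 cannot lower the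
integral. -/

/-! ### Regularity of Haar measure -/

section Regularity

/-- On a `σ`-compact locally compact group every Haar measure is regular. -/
theorem regular_of_isAddHaarMeasure_of_sigmaCompact {G : Type*} [AddCommGroup G]
    [TopologicalSpace G] [IsTopologicalAddGroup G] [LocallyCompactSpace G] [T2Space G]
    [SigmaCompactSpace G] [MeasurableSpace G] [BorelSpace G] (μ : Measure G)
    [μ.IsAddHaarMeasure] : μ.Regular := by
  have key : μ = μ.addHaarScalarFactor Measure.addHaar • (Measure.addHaar : Measure G) := by
    ext s hs
    -- Uniqueness of Haar measure is applied to sets with compact closure; σ-compactness exhausts s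
    -- by such sets.
    have hmono : Monotone fun n => s ∩ compactCovering G n := fun m n hmn =>
      Set.inter_subset_inter_right s (compactCovering_subset G hmn)
    have hU : s = ⋃ n, s ∩ compactCovering G n := by
      rw [← Set.inter_iUnion, iUnion_compactCovering, Set.inter_univ]
    rw [hU, hmono.measure_iUnion, hmono.measure_iUnion]
    congr 1
    ext1 n
    apply Measure.measure_isAddInvariant_eq_smul_of_isCompact_closure
    exact (isCompact_compactCovering G n).closure_of_subset Set.inter_subset_right
  rw [key]
  infer_instance

end Regularity

/-! ### Algebra and inequalities of positive definite functions -/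

namespace PositiveDefinite

variable {G : Type*} [AddCommGroup G] {f g : G → ℝ}

/-- With coefficients 1 and i at x and 0, the imaginary part of the form is f (-x) - f x, and it
must vanish. -/
theorem neg_apply (hf : PositiveDefinite f) (x : G) : f (-x) = f x := by
  have h := (Complex.nonneg_iff.mp (hf 2 ![1, Complex.I] ![x, 0])).2
  simp [Fin.sum_univ_two] at h
  linarith

theorem quadratic_nonneg (hf : PositiveDefinite f) {ι : Type*} [Fintype ι] (c : ι → ℝ)
    (x : ι → G) : 0 ≤ ∑ i, ∑ j, c i * c j * f (x i - x j) := by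
  let e := (Fintype.equivFin ι).symm
  have h := hf _ (fun i => (c (e i) : ℂ)) (fun i => x (e i))
  simp only [Complex.conj_ofReal] at h
  rw [← e.sum_comp]
  simp_rw [← e.sum_comp (fun j => c _ * c j * f (x _ - x j))]
  exact_mod_cast h

/-- Evenness cancels the mixed real-imaginary terms, leaving the real forms of the real and
imaginary parts of c. -/
theorem of_even_of_quadratic_nonneg (heven : ∀ x, f (-x) = f x)
    (h : ∀ (n : ℕ) (c : Fin n → ℝ) (x : Fin n → G),
      0 ≤ ∑ i, ∑ j, c i * c j * f (x i - x j)) : PositiveDefinite f := by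
  intro n c x
  have hswap : ∑ i, ∑ j, (c i).re * (c j).im * f (x i - x j)
      = ∑ i, ∑ j, (c i).im * (c j).re * f (x i - x j) := by
    rw [Finset.sum_comm]
    refine Finset.sum_congr rfl fun i _ => Finset.sum_congr rfl fun j _ => ?_
    rw [← heven (x i - x j), neg_sub]
    ring
  rw [Complex.nonneg_iff]
  constructor
  · have := add_nonneg (h n (fun i => (c i).re) x) (h n (fun i => (c i).im) x)
    simp_rw [← Finset.sum_add_distrib] at this
    simp only [Complex.re_sum, Complex.mul_re, Complex.mul_im, Complex.conj_re, Complex.conj_im,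
      Complex.ofReal_re, Complex.ofReal_im]
    refine this.trans_eq ?_
    refine Finset.sum_congr rfl fun i _ => Finset.sum_congr rfl fun j _ => ?_
    ring
  · rw [← sub_eq_zero] at hswap
    simp_rw [← Finset.sum_sub_distrib] at hswap
    simp only [Complex.im_sum, Complex.mul_re, Complex.mul_im, Complex.conj_re, Complex.conj_im,
      Complex.ofReal_re, Complex.ofReal_im]
    rw [← neg_eq_zero, ← Finset.sum_neg_distrib] at hswap
    simp_rw [← Finset.sum_neg_distrib] at hswap
    refine hswap.symm.trans ?_
    refine Finset.sum_congr rfl fun i _ => Finset.sum_congr rfl fun j _ => ?_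
    ring

theorem zero_nonneg (hf : PositiveDefinite f) : 0 ≤ f 0 := by
  simpa using hf.quadratic_nonneg (ι := Unit) (fun _ => 1) (fun _ => 0)

theorem abs_le (hf : PositiveDefinite f) (x : G) : |f x| ≤ f 0 := by
  have h1 := hf.quadratic_nonneg ![1, 1] ![x, 0]
  have h2 := hf.quadratic_nonneg ![1, -1] ![x, 0]
  simp [Fin.sum_univ_two, hf.neg_apply] at h1 h2
  rw [_root_.abs_le]
  constructor <;> linarith

/-- Krein's inequality. -/
theorem sq_sub_le (hf : PositiveDefinite f) (x y : G) :
    (f (y + x) - f y) ^ 2 ≤ 2 * f 0 * (f 0 - f x) := by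
  -- The form with weights t, 1, -1 at y + x, 0, x; the bound is its discriminant condition in t.
  have h : ∀ t : ℝ, 0 ≤ f 0 * (t * t) + 2 * (f (y + x) - f y) * t + 2 * (f 0 - f x) := by
    intro t
    have h := hf.quadratic_nonneg ![t, 1, -1] ![y + x, 0, x]
    have e2 : f (-x + -y) = f (y + x) := by rw [← hf.neg_apply (y + x), neg_add_rev]
    simp [Fin.sum_univ_three, hf.neg_apply, e2] at h
    linarith
  have := discrim_le_zero h
  rw [discrim] at this
  nlinarith

theorem add (hf : PositiveDefinite f) (hg : PositiveDefinite g) :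
    PositiveDefinite fun x => f x + g x := by
  refine of_even_of_quadratic_nonneg (fun x => by rw [hf.neg_apply, hg.neg_apply]) ?_
  intro n c x
  simp_rw [mul_add, Finset.sum_add_distrib]
  exact add_nonneg (hf.quadratic_nonneg c x) (hg.quadratic_nonneg c x)

theorem const_mul (hf : PositiveDefinite f) {a : ℝ} (ha : 0 ≤ a) :
    PositiveDefinite fun x => a * f x := by
  refine of_even_of_quadratic_nonneg (fun x => by rw [hf.neg_apply]) ?_
  intro n c x
  simp_rw [mul_left_comm _ a, ← Finset.mul_sum]
  exact mul_nonneg ha (hf.quadratic_nonneg c x)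

theorem of_tendsto {F : ℕ → G → ℝ} (hF : ∀ k, PositiveDefinite (F k))
    (hlim : ∀ x, Filter.Tendsto (fun k => F k x) Filter.atTop (𝓝 (f x))) :
    PositiveDefinite f := by
  refine of_even_of_quadratic_nonneg (fun x => ?_) ?_
  · refine tendsto_nhds_unique (hlim (-x)) ?_
    simpa only [(hF _).neg_apply] using hlim x
  · intro n c x
    refine ge_of_tendsto' (x := Filter.atTop)
      (tendsto_finsetSum _ fun i _ => tendsto_finsetSum _ fun j _ =>
        (hlim (x i - x j)).const_mul (c i * c j)) fun k => (hF k).quadratic_nonneg c x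

/-- The convolution of `f` with `(δ₀ + δ_x) * (δ₀ + δ_{-x}) / 4` is positive definite. -/
theorem average (hf : PositiveDefinite f) (x : G) :
    PositiveDefinite fun y => (2 * f y + f (y + x) + f (y + -x)) / 4 := by
  refine of_even_of_quadratic_nonneg (fun y => ?_) ?_
  · have e1 : f (-y + x) = f (y + -x) := by rw [← hf.neg_apply]; congr 1; abel
    have e2 : f (-y + -x) = f (y + x) := by rw [← hf.neg_apply]; congr 1; abel
    rw [hf.neg_apply, e1, e2]
    ring
  · intro n c z
    have h := hf.quadratic_nonneg (Sum.elim c c) (Sum.elim z fun i => z i + x)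
    simp only [Fintype.sum_sum_type, Sum.elim_inl, Sum.elim_inr, ← Finset.sum_add_distrib] at h
    refine (div_nonneg h zero_le_four).trans_eq ?_
    rw [Finset.sum_div]
    refine Finset.sum_congr rfl fun i _ => ?_
    rw [Finset.sum_div]
    refine Finset.sum_congr rfl fun j _ => ?_
    have e1 : z i - (z j + x) = z i - z j + -x := by abel
    have e2 : z i + x - z j = z i - z j + x := by abel
    rw [e1, e2, add_sub_add_right_eq_sub]
    ring

end PositiveDefinite

/-! ### Strong compactness for convex sets -/

section Hilbert

variable {E : Type*} [NormedAddCommGroup E] [InnerProductSpace ℝ E] [CompleteSpace E]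

/-- In a Hilbert space a decreasing sequence of nonempty, uniformly bounded convex sets has closures
with a common point. -/
theorem exists_mem_iInter_closure_of_convex {K : ℕ → Set E} (hanti : Antitone K)
    (hne : ∀ n, (K n).Nonempty) (hconv : ∀ n, Convex ℝ (K n)) {R : ℝ}
    (hR : ∀ n, ∀ v ∈ K n, ‖v‖ ≤ R) : ∃ v, ∀ n, v ∈ closure (K n) := by
  let m : ℕ → ℝ := fun n => sInf ((fun v => ‖v‖ ^ 2) '' K n)
  have hbdd : ∀ n, BddBelow ((fun v : E => ‖v‖ ^ 2) '' K n) := fun n =>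
    ⟨0, by rintro _ ⟨v, -, rfl⟩; positivity⟩
  have hm_le : ∀ n, ∀ v ∈ K n, m n ≤ ‖v‖ ^ 2 := fun n v hv =>
    csInf_le (hbdd n) (Set.mem_image_of_mem _ hv)
  have hm_mono : Monotone m := fun i j hij =>
    csInf_le_csInf (hbdd i) ((hne j).image _) (Set.image_mono (hanti hij))
  have hm_bdd : BddAbove (Set.range m) := by
    refine ⟨R ^ 2, ?_⟩
    rintro _ ⟨n, rfl⟩
    obtain ⟨v, hv⟩ := hne n
    exact (hm_le n v hv).trans (pow_le_pow_left₀ (norm_nonneg v) (hR n v hv) 2)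
  have hm_lim := tendsto_atTop_ciSup hm_mono hm_bdd
  have hm_sup : ∀ n, m n ≤ ⨆ i, m i := le_ciSup hm_bdd
  have hex : ∀ n : ℕ, ∃ v ∈ K n, ‖v‖ ^ 2 < m n + 1 / ((n : ℝ) + 1) := by
    intro n
    obtain ⟨_, ⟨v, hv, rfl⟩, hlt⟩ := exists_lt_of_csInf_lt ((hne n).image fun v => ‖v‖ ^ 2)
      (lt_add_of_pos_right (m n) (Nat.one_div_pos_of_nat (α := ℝ) (n := n)))
    exact ⟨v, hv, hlt⟩
  choose v hvK hv using hex
  -- The midpoint lies in K i, so its squared norm is at least m i; the parallelogram law then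
  -- bounds the distance.
  have hdist : ∀ i j, i ≤ j →
      ‖v i - v j‖ ^ 2 ≤ 4 * ((⨆ k, m k) - m i + 1 / ((i : ℝ) + 1)) := by
    intro i j hij
    have hmid : (1 / 2 : ℝ) • v i + (1 / 2 : ℝ) • v j ∈ K i :=
      hconv i (hvK i) (hanti hij (hvK j)) (by norm_num) (by norm_num) (by norm_num)
    have h1 := hm_le i _ hmid
    rw [← smul_add, norm_smul, mul_pow] at h1
    have h2 := parallelogram_law_with_norm ℝ (v i) (v j)
    have h3 : (1 : ℝ) / ((j : ℝ) + 1) ≤ 1 / ((i : ℝ) + 1) := by gcongr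
    have h4 := hv i
    have h5 := hv j
    have h6 := hm_sup i
    have h7 := hm_sup j
    norm_num at h1
    nlinarith
  have hlim0 : Filter.Tendsto (fun i : ℕ => 4 * ((⨆ k, m k) - m i + 1 / ((i : ℝ) + 1)))
      Filter.atTop (𝓝 0) := by
    have := ((tendsto_const_nhds (x := ⨆ k, m k)).sub hm_lim).add
      (tendsto_one_div_add_atTop_nhds_zero_nat (𝕜 := ℝ))
    simpa using this.const_mul 4
  have hcauchy : CauchySeq v := by
    rw [Metric.cauchySeq_iff']
    intro ε hε
    obtain ⟨N, hN⟩ := (hlim0.eventually (gt_mem_nhds (pow_pos hε 2))).exists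
    refine ⟨N, fun n hn => ?_⟩
    rw [dist_comm, dist_eq_norm]
    exact lt_of_pow_lt_pow_left₀ 2 hε.le ((hdist N n hn).trans_lt hN)
  obtain ⟨w, hw⟩ := cauchySeq_tendsto_of_complete hcauchy
  refine ⟨w, fun n => mem_closure_of_tendsto hw ?_⟩
  filter_upwards [Filter.eventually_ge_atTop n] with k hk using hanti hk (hvK k)

end Hilbert

/-! ### Translations on L² and autocorrelations -/

section Translation

variable {G : Type*} [AddCommGroup G] [TopologicalSpace G] [IsTopologicalAddGroup G]
  [MeasurableSpace G] [BorelSpace G]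

/-- Translation by `x` on `L²`, as a linear isometry. -/
noncomputable def translateL2 (μ : Measure G) [μ.IsAddHaarMeasure] (x : G) :
    Lp ℝ 2 μ →ₗᵢ[ℝ] Lp ℝ 2 μ :=
  Lp.compMeasurePreservingₗᵢ ℝ (fun y => y + x) (measurePreserving_add_right μ x)

variable {μ : Measure G} [μ.IsAddHaarMeasure]

theorem translateL2_toLp (x : G) {g : G → ℝ} (hg : MemLp g 2 μ) :
    translateL2 μ x (hg.toLp g)
      = (hg.comp_measurePreserving (measurePreserving_add_right μ x)).toLp _ := rfl

theorem translateL2_translateL2 (x y : G) (u : Lp ℝ 2 μ) :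
    translateL2 μ x (translateL2 μ y u) = translateL2 μ (x + y) u := by
  refine (Lp.compMeasurePreserving_comp_apply u (measurePreserving_add_right μ y)
    (measurePreserving_add_right μ x)).symm.trans ?_
  have : (fun z : G => z + y) ∘ (fun z => z + x) = fun z => z + (x + y) := by
    funext z
    simp [add_assoc]
  change Lp.compMeasurePreserving _ _ u = Lp.compMeasurePreserving _ _ u
  congr 2

theorem translateL2_zero (u : Lp ℝ 2 μ) : translateL2 μ 0 u = u := by
  refine Lp.ext ((Lp.coeFn_compMeasurePreserving u (measurePreserving_add_right μ 0)).trans ?_)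
  refine Filter.Eventually.of_forall fun x => ?_
  simp

theorem inner_translateL2_sub (x y : G) (u : Lp ℝ 2 μ) :
    inner ℝ (translateL2 μ (x - y) u) u = inner ℝ (translateL2 μ x u) (translateL2 μ y u) := by
  rw [← (translateL2 μ y).inner_map_map, translateL2_translateL2, add_sub_cancel]

/-- The matrix of values at differences is the Gram matrix of the translates of u. -/
theorem positiveDefinite_inner_translateL2 (u : Lp ℝ 2 μ) :
    PositiveDefinite fun x => inner ℝ (translateL2 μ x u) u := by
  refine PositiveDefinite.of_even_of_quadratic_nonneg (fun x => ?_) fun n c x => ?_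
  · rw [← zero_sub, inner_translateL2_sub, translateL2_zero, real_inner_comm]
  · have h := real_inner_self_nonneg (x := ∑ i, c i • translateL2 μ (x i) u)
    simp_rw [sum_inner, inner_sum, real_inner_smul_left, real_inner_smul_right] at h
    simp_rw [inner_translateL2_sub, mul_assoc]
    exact h

theorem continuous_translateL2 [LocallyCompactSpace G] [T2Space G] [μ.Regular] (u : Lp ℝ 2 μ) :
    Continuous fun x => translateL2 μ x u :=
  continuous_const.compMeasurePreservingLp
    (ContinuousMap.curry ⟨fun p : G × G => p.2 + p.1, by fun_prop⟩).continuous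
    (fun x => measurePreserving_add_right μ x) (by norm_num)

end Translation

/-! ### Continuous representatives of L² limits -/

section ContinuousRepresentative

variable {G : Type*} [AddCommGroup G] [TopologicalSpace G] [IsTopologicalAddGroup G]
  [MeasurableSpace G] [BorelSpace G] {μ : Measure G} [μ.IsAddHaarMeasure]

/-- The function `g` is continuous, positive definite, square integrable, and at `L²`-distance less
than `ε` from `u`. -/
def IsPosDefApprox (u : Lp ℝ 2 μ) (ε : ℝ) (g : G → ℝ) : Prop :=
  Continuous g ∧ PositiveDefinite g ∧ ∃ hg : MemLp g 2 μ, ‖hg.toLp g - u‖ < ε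

omit [IsTopologicalAddGroup G] [BorelSpace G] [μ.IsAddHaarMeasure] in
theorem IsPosDefApprox.mono {u : Lp ℝ 2 μ} {ε δ : ℝ} {g : G → ℝ} (h : IsPosDefApprox u ε g)
    (hεδ : ε ≤ δ) : IsPosDefApprox u δ g :=
  ⟨h.1, h.2.1, h.2.2.imp fun _ h' => h'.trans_le hεδ⟩

/-- Averaging is an L² contraction and moves u by less than ε / 4, so the total error stays below ε
/ 2 + ε / 4. -/
theorem IsPosDefApprox.average {u : Lp ℝ 2 μ} {ε : ℝ} {g : G → ℝ}
    (h : IsPosDefApprox u (ε / 2) g) {x : G} (hx : ‖translateL2 μ x u - u‖ < ε / 2)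
    (hx' : ‖translateL2 μ (-x) u - u‖ < ε / 2) :
    IsPosDefApprox u ε fun y => (2 * g y + g (y + x) + g (y + -x)) / 4 := by
  obtain ⟨hc, hpd, hg, hlt⟩ := h
  refine ⟨by fun_prop, hpd.average x, ?_⟩
  have h1 := hg.comp_measurePreserving (measurePreserving_add_right μ x)
  have h2 := hg.comp_measurePreserving (measurePreserving_add_right μ (-x))
  have h3 := (((hg.const_smul (2 : ℝ)).add h1).add h2).const_smul (1 / 4 : ℝ)
  have e : (fun y => (2 * g y + g (y + x) + g (y + -x)) / 4)
      = (1 / 4 : ℝ) • ((2 : ℝ) • g + g ∘ (fun y => y + x) + g ∘ (fun y => y + -x)) := by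
    funext y
    simp
    ring
  rw [e]
  refine ⟨h3, ?_⟩
  have e3 : h3.toLp _ - u = (1 / 4 : ℝ) • ((2 : ℝ) • (hg.toLp g - u)
      + translateL2 μ x (hg.toLp g - u) + translateL2 μ (-x) (hg.toLp g - u)
      + (translateL2 μ x u - u) + (translateL2 μ (-x) u - u)) := by
    have : h3.toLp _ = (1 / 4 : ℝ) • ((2 : ℝ) • hg.toLp g
      + translateL2 μ x (hg.toLp g) + translateL2 μ (-x) (hg.toLp g)) := rfl
    rw [this, map_sub, map_sub]
    module
  rw [e3, norm_smul]
  have t1 := norm_add_le ((2 : ℝ) • (hg.toLp g - u)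
      + translateL2 μ x (hg.toLp g - u) + translateL2 μ (-x) (hg.toLp g - u)
      + (translateL2 μ x u - u)) (translateL2 μ (-x) u - u)
  have t2 := norm_add_le ((2 : ℝ) • (hg.toLp g - u)
      + translateL2 μ x (hg.toLp g - u) + translateL2 μ (-x) (hg.toLp g - u))
      (translateL2 μ x u - u)
  have t3 := norm_add₃_le (a := (2 : ℝ) • (hg.toLp g - u))
      (b := translateL2 μ x (hg.toLp g - u)) (c := translateL2 μ (-x) (hg.toLp g - u))
  rw [norm_smul, (translateL2 μ x).norm_map, (translateL2 μ (-x)).norm_map] at t3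
  rw [Real.norm_ofNat] at t3
  rw [show ‖(1 / 4 : ℝ)‖ = 1 / 4 by norm_num]
  linarith [norm_nonneg (hg.toLp g - u)]

/-- Near-minimizers of `g ↦ g 0` among positive definite approximations of `u` are almost
equicontinuous. -/
theorem IsPosDefApprox.abs_sub_le {u : Lp ℝ 2 μ} {ε s η : ℝ} {g : G → ℝ}
    (hs : ∀ k, IsPosDefApprox u ε k → s - η ≤ k 0) (h : IsPosDefApprox u (ε / 2) g)
    (hg0 : g 0 ≤ s + η) {x : G} (hx : ‖translateL2 μ x u - u‖ < ε / 2)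
    (hx' : ‖translateL2 μ (-x) u - u‖ < ε / 2) (y : G) :
    (g (y + x) - g y) ^ 2 ≤ 8 * (s + η) * η := by
  have h1 := hs _ (h.average hx hx')
  simp only [zero_add] at h1
  have h0 := h.2.1.zero_nonneg
  rw [h.2.1.neg_apply] at h1
  have h2 := h.2.1.sq_sub_le x y
  -- The average equals (g 0 + g x) / 2 ≥ s - η at 0, while g 0 ≤ s + η.
  have h3 : g 0 - g x ≤ 4 * η := by linarith
  have h4 := (le_abs_self _).trans (h.2.1.abs_le x)
  have h5 : 2 * g 0 * (g 0 - g x) ≤ 2 * (s + η) * (4 * η) := by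
    apply mul_le_mul <;> linarith
  linarith

/-- If two square integrable functions vary little under translations by a set `U`, then their
difference is uniformly controlled by its `L²`-norm. -/
theorem ofReal_sq_mul_measure_le_of_lt_abs_sub {u v : G → ℝ} (hu : MemLp u 2 μ) (hv : MemLp v 2 μ)
    {U : Set G} {κ : ℝ}
    (hu' : ∀ x ∈ U, ∀ y, |u (y + x) - u y| ≤ κ) (hv' : ∀ x ∈ U, ∀ y, |v (y + x) - v y| ≤ κ)
    {y : G} (hy : 3 * κ < |u y - v y|) :
    ENNReal.ofReal κ ^ 2 * μ U ≤ ENNReal.ofReal (‖hu.toLp u - hv.toLp v‖ ^ 2) := by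
  -- On y + U each function moves by at most κ, so a gap above 3κ at y leaves at least κ there;
  -- Chebyshev's inequality finishes.
  have hsub : (fun z => -y + z) ⁻¹' U ⊆ {z | ENNReal.ofReal κ ≤ ‖(u - v) z‖ₑ} := by
    intro z hz
    have h1 := hu' _ hz y
    have h2 := hv' _ hz y
    rw [add_neg_cancel_left] at h1 h2
    simp only [Set.mem_ofPred_eq, Pi.sub_apply]
    rw [Real.enorm_eq_ofReal_abs]
    apply ENNReal.ofReal_le_ofReal
    have e : u y - v y = (u z - v z) + -(u z - u y) + (v z - v y) := by ring
    have := abs_add_three (u z - v z) (-(u z - u y)) (v z - v y)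
    rw [← e, abs_neg] at this
    linarith
  have h1 : μ U ≤ μ {z | ENNReal.ofReal κ ≤ ‖(u - v) z‖ₑ} := by
    rw [← measure_preimage_add μ (-y) U]
    exact measure_mono hsub
  have h2 := mul_meas_ge_le_pow_eLpNorm' μ (p := 2) two_ne_zero (by norm_num)
    (hu.sub hv).aestronglyMeasurable (ENNReal.ofReal κ)
  rw [← MemLp.toLp_sub, Lp.norm_toLp, ENNReal.ofReal_pow ENNReal.toReal_nonneg,
    ENNReal.ofReal_toReal (hu.sub hv).2.ne]
  refine (mul_le_mul_right h1 _).trans ?_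
  simpa using h2

/-- An `L²`-limit of continuous positive definite functions, normalized by `g 0 ≤ 1`, is almost
everywhere equal to a continuous positive definite function. -/
theorem exists_continuous_positiveDefinite_ae_eq [LocallyCompactSpace G] [T2Space G] [μ.Regular]
    (u : Lp ℝ 2 μ) (hu : ∀ ε > 0, ∃ g, IsPosDefApprox u ε g ∧ g 0 ≤ 1) :
    ∃ h : G → ℝ, Continuous h ∧ PositiveDefinite h ∧ h 0 ≤ 1 ∧ h =ᵐ[μ] u := by
  -- The infimum s of S is the least value at 0 achievable asymptotically as ε → 0.
  let S : Set ℝ := {t | ∀ ε > 0, ∃ g, IsPosDefApprox u ε g ∧ g 0 ≤ t}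
  have hS0 : ∀ t ∈ S, 0 ≤ t := fun t ht =>
    let ⟨g, hg, hgt⟩ := ht 1 one_pos
    hg.2.1.zero_nonneg.trans hgt
  have hSb : BddBelow S := ⟨0, hS0⟩
  have h1S : (1 : ℝ) ∈ S := hu
  obtain ⟨s, hs⟩ : ∃ s, s = sInf S := ⟨_, rfl⟩
  have hs0 : 0 ≤ s := hs ▸ le_csInf ⟨1, h1S⟩ hS0
  have hs1 : s ≤ 1 := hs ▸ csInf_le hSb h1S
  have hlow : ∀ η > 0, ∃ ε > 0, ∀ k, IsPosDefApprox u ε k → s - η ≤ k 0 := by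
    intro η hη
    by_contra! hcon
    have : s - η ∈ S := fun ε hε =>
      let ⟨k, hk, hk'⟩ := hcon ε hε
      ⟨k, hk, hk'.le⟩
    have := csInf_le hSb this
    linarith
  have hupp : ∀ η > 0, ∃ g, IsPosDefApprox u η g ∧ g 0 ≤ s + η := by
    intro η hη
    obtain ⟨t, ht, hts⟩ := exists_lt_of_csInf_lt ⟨1, h1S⟩
      (show sInf S < s + η by rw [← hs]; linarith)
    obtain ⟨g, hg, hgt⟩ := ht η hη
    exact ⟨g, hg, hgt.trans hts.le⟩
  choose g hg hg0 using fun n : ℕ => hupp (1 / ((n : ℝ) + 1)) Nat.one_div_pos_of_nat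
  choose hgL hgdist using fun n => (hg n).2.2
  have hzero := tendsto_one_div_add_atTop_nhds_zero_nat (𝕜 := ℝ)
  have hequi : ∀ κ > 0, ∃ U ∈ 𝓝 (0 : G), ∃ N, ∀ n ≥ N, ∀ x ∈ U, ∀ y,
      |g n (y + x) - g n y| ≤ κ := by
    intro κ hκ
    -- As s ≤ 1 and η ≤ 1, the bound 8(s + η)η is at most 16η.
    obtain ⟨η, hη, hη1, hηκ⟩ : ∃ η > 0, η ≤ 1 ∧ 16 * η ≤ κ ^ 2 :=
      ⟨min 1 (κ ^ 2 / 16), by positivity, min_le_left _ _,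
        by linarith [min_le_right 1 (κ ^ 2 / 16)]⟩
    obtain ⟨ε, hε, hlowε⟩ := hlow η hη
    have hc := continuous_translateL2 u
    refine ⟨{x | ‖translateL2 μ x u - u‖ < ε / 2 ∧ ‖translateL2 μ (-x) u - u‖ < ε / 2}, ?_, ?_⟩
    · have hc' := hc.comp continuous_neg
      refine IsOpen.mem_nhds ?_ ?_
      · exact (isOpen_lt (hc.sub continuous_const).norm continuous_const).inter
          (isOpen_lt (hc'.sub continuous_const).norm continuous_const)
      · simp [translateL2_zero, hε]
    · obtain ⟨N, hN⟩ := Filter.eventually_atTop.mp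
        (hzero.eventually (gt_mem_nhds (show 0 < min η (ε / 2) by positivity)))
      refine ⟨N, fun n hn x hx y => ?_⟩
      have hn' := hN n hn
      rw [lt_min_iff] at hn'
      have := ((hg n).mono hn'.2.le).abs_sub_le hlowε ((hg0 n).trans (by linarith)) hx.1 hx.2 y
      rw [← sq_abs] at this
      refine le_of_sq_le_sq ?_ hκ.le
      nlinarith
  have hL2 : Filter.Tendsto (fun n => (hgL n).toLp (g n)) Filter.atTop (𝓝 u) := by
    rw [tendsto_iff_norm_sub_tendsto_zero]
    exact squeeze_zero (fun n => norm_nonneg _) (fun n => (hgdist n).le) hzero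
  have hcauchy : ∀ κ > 0, ∃ N, ∀ m ≥ N, ∀ n ≥ N, ∀ y, |g m y - g n y| ≤ 3 * κ := by
    intro κ hκ
    obtain ⟨U, hU, N, hN⟩ := hequi κ hκ
    have hUpos : 0 < μ U := Measure.measure_pos_of_mem_nhds μ hU
    have hpos : 0 < ENNReal.ofReal κ ^ 2 * μ U :=
      ENNReal.mul_pos (pow_ne_zero 2 (by simpa using hκ)) hUpos.ne'
    obtain ⟨r, hr, hrlt⟩ : ∃ r : ℝ, 0 < r ∧ ENNReal.ofReal (r ^ 2) < ENNReal.ofReal κ ^ 2 * μ U := by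
      have : Filter.Tendsto (fun r : ℝ => ENNReal.ofReal (r ^ 2)) (𝓝[>] 0) (𝓝 0) := by
        have h := (ENNReal.continuous_ofReal.comp (continuous_pow (M := ℝ) 2)).tendsto 0
        simp only [Function.comp_apply, ne_eq, OfNat.ofNat_ne_zero, not_false_eq_true, zero_pow,
            ENNReal.ofReal_zero] at h
        exact h.mono_left nhdsWithin_le_nhds
      obtain ⟨r, hr1, hr2⟩ := ((this.eventually (gt_mem_nhds hpos)).and
        self_mem_nhdsWithin).exists
      exact ⟨r, hr2, hr1⟩
    obtain ⟨M, hM⟩ := Metric.cauchySeq_iff.mp hL2.cauchySeq r hr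
    refine ⟨max M N, fun m hm n hn y => ?_⟩
    by_contra! hy
    have h1 := ofReal_sq_mul_measure_le_of_lt_abs_sub (hgL m) (hgL n)
      (hN m (le_of_max_le_right hm)) (hN n (le_of_max_le_right hn)) hy
    have h2 := hM m (le_of_max_le_left hm) n (le_of_max_le_left hn)
    rw [dist_eq_norm] at h2
    refine absurd (h1.trans (ENNReal.ofReal_le_ofReal ?_)) hrlt.not_ge
    exact pow_le_pow_left₀ (norm_nonneg _) h2.le 2
  have hunif : UniformCauchySeqOn g Filter.atTop Set.univ := by
    rw [Metric.uniformCauchySeqOn_iff]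
    intro ε hε
    obtain ⟨N, hN⟩ := hcauchy (ε / 6) (by positivity)
    refine ⟨N, fun m hm n hn x _ => ?_⟩
    rw [Real.dist_eq]
    linarith [hN m hm n hn x]
  have hex : ∀ x, ∃ t, Filter.Tendsto (fun n => g n x) Filter.atTop (𝓝 t) := fun x =>
    cauchySeq_tendsto_of_complete (hunif.cauchySeq (Set.mem_univ x))
  choose h hh using hex
  have hlim := tendstoUniformlyOn_univ.mp
    (hunif.tendstoUniformlyOn_of_tendsto fun x _ => hh x)
  refine ⟨h, hlim.continuous (Filter.Frequently.of_forall fun n => (hg n).1),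
    .of_tendsto (fun n => (hg n).2.1) hh, ?_, ?_⟩
  · refine le_trans (le_of_tendsto_of_tendsto' (hh 0) (hzero.const_add s) hg0) ?_
    simpa using hs1
  · have hmeas := tendstoInMeasure_of_tendsto_Lp hL2
    obtain ⟨ns, hns, hae⟩ := hmeas.exists_seq_tendsto_ae
    have hco : ∀ᵐ x ∂μ, ∀ n, (hgL n).toLp (g n) x = g n x :=
      ae_all_iff.mpr fun n => (hgL n).coeFn_toLp
    filter_upwards [hae, hco] with x hx hx'
    simp only [hx'] at hx
    exact tendsto_nhds_unique ((hh x).comp hns.tendsto_atTop) hx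

end ContinuousRepresentative

/-! ### Sign conditions, convexity and L² bounds of admissible functions -/

section Admissible

variable {G : Type*} [AddCommGroup G] [TopologicalSpace G] [MeasurableSpace G]
  {μ : Measure G} {Ωp Ωm : Set G}

/-- A continuous function that is almost everywhere nonpositive off a boundary-coherent set is
nonpositive off this set. -/
theorem BoundaryCoherent.nonpos_of_ae {X : Type*} [TopologicalSpace X] [MeasurableSpace X]
    {μ : Measure X} [μ.IsOpenPosMeasure] {Ω : Set X} (hΩ : BoundaryCoherent Ω) {h : X → ℝ}
    (hc : Continuous h) (hae : ∀ᵐ x ∂μ, x ∉ Ω → h x ≤ 0) {x : X} (hx : x ∉ Ω) : h x ≤ 0 := by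
  have hext : ∀ y ∈ (closure Ω)ᶜ, h y ≤ 0 := by
    intro y hy
    by_contra! hpos
    have hopen : IsOpen ((closure Ω)ᶜ ∩ {z | 0 < h z}) :=
      isClosed_closure.isOpen_compl.inter (isOpen_lt continuous_const hc)
    refine (hopen.measure_pos μ ⟨y, hy, hpos⟩).ne' (measure_mono_null ?_ hae)
    rintro z ⟨hz1, hz2⟩ hz3
    exact (hz3 fun hz => hz1 (subset_closure hz)).not_gt hz2
  have hcl : closure (closure Ω)ᶜ ⊆ {y | h y ≤ 0} :=
    closure_minimal hext (isClosed_le hc continuous_const)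
  by_cases hx' : x ∈ closure Ω
  · exact hcl (hΩ ⟨hx', fun hi => hx (interior_subset hi)⟩)
  · exact hext x hx'

theorem abs_le_one_of_mem_admissibleClass {f : G → ℝ} (hf : f ∈ admissibleClass μ Ωp Ωm) (x : G) :
    |f x| ≤ 1 :=
  hf.1.2.2 ▸ hf.1.2.1.abs_le x

theorem nonpos_of_mem_admissibleClass {f : G → ℝ} (hf : f ∈ admissibleClass μ Ωp Ωm) {x : G}
    (hx : x ∉ Ωp) : f x ≤ 0 :=
  not_lt.mp fun h => hx (hf.2.2.1 h)

theorem nonneg_of_mem_admissibleClass {f : G → ℝ} (hf : f ∈ admissibleClass μ Ωp Ωm) {x : G}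
    (hx : x ∉ Ωm) : 0 ≤ f x :=
  not_lt.mp fun h => hx (hf.2.2.2 h)

theorem le_indicator_of_mem_admissibleClass {f : G → ℝ} (hf : f ∈ admissibleClass μ Ωp Ωm)
    {M : Set G} (hM : Ωp ⊆ M) (x : G) : f x ≤ M.indicator 1 x := by
  by_cases hx : x ∈ M
  · rw [Set.indicator_of_mem hx]
    exact (le_abs_self _).trans (abs_le_one_of_mem_admissibleClass hf x)
  · rw [Set.indicator_of_notMem hx]
    exact nonpos_of_mem_admissibleClass hf fun h => hx (hM h)

omit [AddCommGroup G] [TopologicalSpace G] in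
theorem integrable_indicator_one_of_measure_ne_top {M : Set G} (hMm : MeasurableSet M)
    (hMfin : μ M ≠ ⊤) : Integrable (M.indicator (1 : G → ℝ)) μ :=
  (integrable_indicator_iff hMm).mpr (integrableOn_const (C := (1 : ℝ)) hMfin)

theorem integral_le_of_mem_admissibleClass {f : G → ℝ} (hf : f ∈ admissibleClass μ Ωp Ωm)
    {M : Set G} (hMm : MeasurableSet M) (hM : Ωp ⊆ M) (hMfin : μ M ≠ ⊤) :
    ∫ x, f x ∂μ ≤ μ.real M := by
  rw [← integral_indicator_one hMm]
  exact integral_mono hf.2.1 (integrable_indicator_one_of_measure_ne_top hMm hMfin)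
    (le_indicator_of_mem_admissibleClass hf hM)

theorem convex_combination_mem_admissibleClass {f g : G → ℝ} (hf : f ∈ admissibleClass μ Ωp Ωm)
    (hg : g ∈ admissibleClass μ Ωp Ωm) {a b : ℝ} (ha : 0 ≤ a) (hb : 0 ≤ b) (hab : a + b = 1) :
    (fun x => a * f x + b * g x) ∈ admissibleClass μ Ωp Ωm := by
  have hfc := hf.1.1
  have hgc := hg.1.1
  refine ⟨⟨by fun_prop, (hf.1.2.1.const_mul ha).add (hg.1.2.1.const_mul hb), ?_⟩,
    (hf.2.1.const_mul a).add (hg.2.1.const_mul b), fun x hx => ?_, fun x hx => ?_⟩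
  · simp [hf.1.2.2, hg.1.2.2, hab]
  · by_contra hxn
    have h1 := mul_nonpos_of_nonneg_of_nonpos ha (nonpos_of_mem_admissibleClass hf hxn)
    have h2 := mul_nonpos_of_nonneg_of_nonpos hb (nonpos_of_mem_admissibleClass hg hxn)
    exact (add_nonpos h1 h2).not_gt hx
  · by_contra hxn
    have h1 := mul_nonneg ha (nonneg_of_mem_admissibleClass hf hxn)
    have h2 := mul_nonneg hb (nonneg_of_mem_admissibleClass hg hxn)
    exact (add_nonneg h1 h2).not_gt hx

theorem memLp_two_of_mem_admissibleClass {f : G → ℝ} (hf : f ∈ admissibleClass μ Ωp Ωm) :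
    MemLp f 2 μ := by
  rw [memLp_two_iff_integrable_sq hf.2.1.aestronglyMeasurable]
  refine hf.2.1.mono (hf.2.1.aestronglyMeasurable.pow 2) (Filter.Eventually.of_forall fun x => ?_)
  have := abs_le_one_of_mem_admissibleClass hf x
  rw [norm_pow, Real.norm_eq_abs]
  exact pow_le_of_le_one (abs_nonneg _) this two_ne_zero

/-- The `L²`-norm of an admissible function is controlled by its integral. -/
theorem norm_toLp_sq_le_of_mem_admissibleClass {f : G → ℝ} (hf : f ∈ admissibleClass μ Ωp Ωm)
    {M : Set G} (hMm : MeasurableSet M) (hM : Ωp ⊆ M) (hMfin : μ M ≠ ⊤) :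
    ‖(memLp_two_of_mem_admissibleClass hf).toLp f‖ ^ 2 ≤ 2 * μ.real M - ∫ x, f x ∂μ := by
  have h1 : ‖(memLp_two_of_mem_admissibleClass hf).toLp f‖ ^ 2 = ∫ x, f x ^ 2 ∂μ := by
    rw [← real_inner_self_eq_norm_sq, L2.inner_def]
    refine integral_congr_ae ?_
    filter_upwards [(memLp_two_of_mem_admissibleClass hf).coeFn_toLp] with x hx
    simp [hx]
  have hind : Integrable (M.indicator (1 : G → ℝ)) μ :=
    integrable_indicator_one_of_measure_ne_top hMm hMfin
  rw [h1, ← integral_indicator_one hMm, ← integral_const_mul,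
    ← integral_sub (hind.const_mul 2) hf.2.1]
  refine integral_mono (memLp_two_of_mem_admissibleClass hf).integrable_sq
    ((hind.const_mul 2).sub hf.2.1) fun x => ?_
  -- Pointwise f² + f ≤ 2 on M because |f| ≤ 1, and f² ≤ -f off M because -1 ≤ f ≤ 0.
  have h2 := abs_le.mp (abs_le_one_of_mem_admissibleClass hf x)
  change f x ^ 2 ≤ 2 * M.indicator 1 x - f x
  have h3 := le_indicator_of_mem_admissibleClass hf hM x
  by_cases hx : x ∈ M
  · simp only [Set.indicator_of_mem hx, Pi.one_apply]
    nlinarith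
  · rw [Set.indicator_of_notMem hx] at h3 ⊢
    nlinarith

end Admissible

/-! ### An admissible function with positive integral -/

section Nonempty

variable {G : Type*} [AddCommGroup G] [TopologicalSpace G] [IsTopologicalAddGroup G]
  [LocallyCompactSpace G] [T2Space G] [MeasurableSpace G] [BorelSpace G]

/-- The normalized autocorrelation of the indicator of a compact neighbourhood K of 0 with K - K ⊆
Ωp. Positivity of the extremal value later rules out a zero limit. -/
theorem exists_mem_admissibleClass_integral_pos (μ : Measure G) [μ.IsAddHaarMeasure] [μ.Regular]
    {Ωp : Set G} (Ωm : Set G) (hΩ : Ωp ∈ 𝓝 (0 : G)) :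
    ∃ f ∈ admissibleClass μ Ωp Ωm, 0 < ∫ x, f x ∂μ := by
  obtain ⟨W, hW, hWΩ⟩ : ∃ W ∈ 𝓝 (0 : G), ∀ v ∈ W, ∀ w ∈ W, v - w ∈ Ωp := by
    have h : (fun p : G × G => p.1 - p.2) ⁻¹' Ωp ∈ 𝓝 ((0 : G), (0 : G)) :=
      (continuous_sub.tendsto ((0 : G), (0 : G))) (by simpa using hΩ)
    obtain ⟨A, hA, B, hB, hAB⟩ := mem_nhds_prod_iff.mp h
    exact ⟨A ∩ B, Filter.inter_mem hA hB, fun v hv w hw =>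
      hAB (show (v, w) ∈ A ×ˢ B from ⟨hv.1, hw.2⟩)⟩
  obtain ⟨K, hK, hKW, hKc⟩ := local_compact_nhds hW
  have hKm : MeasurableSet K := hKc.measurableSet
  have hKfin : μ K ≠ ⊤ := hKc.measure_lt_top.ne
  have hKpos : 0 < μ.real K :=
    ENNReal.toReal_pos (Measure.measure_pos_of_mem_nhds μ hK).ne' hKfin
  let u : Lp ℝ 2 μ := indicatorConstLp 2 hKm hKfin 1
  have hval : ∀ x, inner ℝ (translateL2 μ x u) u = μ.real ((fun y => y + x) ⁻¹' K ∩ K) := fun x =>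
    L2.real_inner_indicatorConstLp_one_indicatorConstLp_one
      (hKm.preimage (measurable_add_const x)) hKm
      (by rwa [(measurePreserving_add_right μ x).measure_preimage hKm.nullMeasurableSet])
  let f : G → ℝ := fun x => (μ.real K)⁻¹ * inner ℝ (translateL2 μ x u) u
  have hfc : Continuous f :=
    continuous_const.mul ((continuous_translateL2 u).inner continuous_const)
  have hf0 : f 0 = 1 := by
    simp only [f, hval]
    simp [hKpos.ne']
  have hfnonneg : ∀ x, 0 ≤ f x := fun x => by
    simp only [f, hval]
    positivity
  have hfsupp : ∀ x, f x ≠ 0 → ∃ v ∈ K, ∃ w ∈ K, v - w = x := by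
    intro x hx
    simp only [f, hval] at hx
    obtain ⟨y, hy1, hy2⟩ := nonempty_of_measureReal_ne_zero (right_ne_zero_of_mul hx)
    exact ⟨y + x, hy1, y, hy2, add_sub_cancel_left y x⟩
  have hcomp : HasCompactSupport f :=
    .of_support_subset_isCompact ((hKc.prod hKc).image continuous_sub) fun x hx =>
      let ⟨v, hv, w, hw, hvw⟩ := hfsupp x hx
      ⟨(v, w), ⟨hv, hw⟩, hvw⟩
  refine ⟨f, ⟨⟨hfc, (positiveDefinite_inner_translateL2 u).const_mul (by positivity), hf0⟩,
    hfc.integrable_of_hasCompactSupport hcomp, fun x hx => ?_, fun x hx => ?_⟩,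
    hfc.integral_pos_of_hasCompactSupport_nonneg_nonzero hcomp hfnonneg
      (x := 0) (by rw [hf0]; exact one_ne_zero)⟩
  · obtain ⟨v, hv, w, hw, rfl⟩ := hfsupp x (ne_of_gt hx)
    exact hWΩ v (hKW hv) w (hKW hw)
  · exact absurd hx (hfnonneg x).not_gt

end Nonempty

/-! ### Maximizing sequences and passage to the limit -/

section Maximizer

variable {G : Type*} [AddCommGroup G] [TopologicalSpace G] [MeasurableSpace G]
  {μ : Measure G} {Ωp Ωm : Set G}

theorem coe_integral_eq_extremalValue {C : ℝ} {f : G → ℝ} (hf : f ∈ admissibleClass μ Ωp Ωm)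
    (hfC : C ≤ ∫ x, f x ∂μ)
    (hC : ∀ g ∈ admissibleClass μ Ωp Ωm, ∫ x, g x ∂μ ≤ C) :
    ((∫ x, f x ∂μ : ℝ) : EReal) = extremalValue μ Ωp Ωm := by
  rw [extremalValue, if_pos ⟨f, hf⟩]
  refine le_antisymm (le_iSup₂_of_le f hf le_rfl) (iSup₂_le fun g hg => ?_)
  exact EReal.coe_le_coe_iff.mpr ((hC g hg).trans hfC)

/-- Reverse Fatou lemma for almost everywhere convergent admissible functions. -/
theorem integrable_and_le_integral_of_tendsto_admissibleClass {F : ℕ → G → ℝ} {h : G → ℝ} {C : ℝ}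
    (hF : ∀ n, F n ∈ admissibleClass μ Ωp Ωm) (hh : AEStronglyMeasurable h μ)
    (hlim : ∀ᵐ x ∂μ, Filter.Tendsto (fun n => F n x) Filter.atTop (𝓝 (h x)))
    {c : ℕ → ℝ} (hc : Filter.Tendsto c Filter.atTop (𝓝 C)) (hFc : ∀ n, c n ≤ ∫ x, F n x ∂μ)
    {M : Set G} (hMm : MeasurableSet M) (hM : Ωp ⊆ M) (hMfin : μ M ≠ ⊤) :
    Integrable h μ ∧ C ≤ ∫ x, h x ∂μ := by
  have hind : Integrable (M.indicator (1 : G → ℝ)) μ :=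
    integrable_indicator_one_of_measure_ne_top hMm hMfin
  -- Fatou is applied to the nonnegative functions 1_M - F n.
  have hsub : ∀ n, ∫⁻ x, ENNReal.ofReal (M.indicator 1 x - F n x) ∂μ
      ≤ ENNReal.ofReal (μ.real M - c n) := by
    intro n
    rw [← ofReal_integral_eq_lintegral_ofReal (f := fun x => M.indicator 1 x - F n x)
      (hind.sub (hF n).2.1) (Filter.Eventually.of_forall fun x =>
        sub_nonneg.mpr (le_indicator_of_mem_admissibleClass (hF n) hM x))]
    apply ENNReal.ofReal_le_ofReal
    rw [integral_sub hind (hF n).2.1, integral_indicator_one hMm]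
    linarith [hFc n]
  have hle : ∀ᵐ x ∂μ, h x ≤ M.indicator 1 x := by
    filter_upwards [hlim] with x hx
    exact le_of_tendsto' hx fun n => le_indicator_of_mem_admissibleClass (hF n) hM x
  have hle' : 0 ≤ᵐ[μ] fun x => M.indicator 1 x - h x := by
    filter_upwards [hle] with x hx using sub_nonneg.mpr hx
  have hfatou : ∫⁻ x, ENNReal.ofReal (M.indicator 1 x - h x) ∂μ
      ≤ ENNReal.ofReal (μ.real M - C) := by
    calc ∫⁻ x, ENNReal.ofReal (M.indicator 1 x - h x) ∂μ
        = ∫⁻ x, Filter.liminf (fun n => ENNReal.ofReal (M.indicator 1 x - F n x))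
            Filter.atTop ∂μ := by
          refine lintegral_congr_ae ?_
          filter_upwards [hlim] with x hx
          exact (ENNReal.tendsto_ofReal (hx.const_sub _)).liminf_eq.symm
      _ ≤ Filter.liminf (fun n => ∫⁻ x, ENNReal.ofReal (M.indicator 1 x - F n x) ∂μ)
            Filter.atTop := lintegral_liminf_le' fun n =>
          ((hind.sub (hF n).2.1).aestronglyMeasurable.aemeasurable).ennreal_ofReal
      _ ≤ Filter.liminf (fun n => ENNReal.ofReal (μ.real M - c n)) Filter.atTop :=
          Filter.liminf_le_liminf (Filter.Eventually.of_forall hsub)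
      _ = ENNReal.ofReal (μ.real M - C) :=
          (ENNReal.tendsto_ofReal (hc.const_sub _)).liminf_eq
  have hint : Integrable (fun x => M.indicator 1 x - h x) μ :=
    (lintegral_ofReal_ne_top_iff_integrable (hind.aestronglyMeasurable.sub hh) hle').mp
      (hfatou.trans_lt ENNReal.ofReal_lt_top).ne
  have hhint : Integrable h μ := by
    refine (hind.sub hint).congr (Filter.Eventually.of_forall fun x => ?_)
    simp
  refine ⟨hhint, ?_⟩
  -- `ENNReal.ofReal` truncates at 0, so nonnegativity of μ(M) - C is needed to return to real
  -- integrals.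
  have hCM : C ≤ μ.real M := le_of_tendsto' hc fun n =>
    (hFc n).trans (integral_le_of_mem_admissibleClass (hF n) hMm hM hMfin)
  rw [← ofReal_integral_eq_lintegral_ofReal hint hle',
    ENNReal.ofReal_le_ofReal_iff (sub_nonneg.mpr hCM), integral_sub hind hhint,
    integral_indicator_one hMm] at hfatou
  linarith

/-- Admissible functions with integrals close to the supremum can be chosen convergent in `L²`. -/
theorem exists_maximizing_seq_tendsto_Lp {C : ℝ} (hC0 : 0 ≤ C)
    (hC : ∀ ε > 0, ∃ f ∈ admissibleClass μ Ωp Ωm, C - ε < ∫ x, f x ∂μ)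
    {M : Set G} (hMm : MeasurableSet M) (hM : Ωp ⊆ M) (hMfin : μ M ≠ ⊤) :
    ∃ (u : Lp ℝ 2 μ) (F : ℕ → G → ℝ) (hF : ∀ n, F n ∈ admissibleClass μ Ωp Ωm),
      (∀ n, C - 1 / (((n : ℕ) : ℝ) + 1) ≤ ∫ x, F n x ∂μ) ∧
      Filter.Tendsto (fun n => (memLp_two_of_mem_admissibleClass (hF n)).toLp (F n))
        Filter.atTop (𝓝 u) := by
  let K : ℕ → Set (Lp ℝ 2 μ) := fun n => {v | ∃ (f : G → ℝ) (hf : f ∈ admissibleClass μ Ωp Ωm),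
    C - 1 / ((n : ℝ) + 1) ≤ ∫ x, f x ∂μ ∧ (memLp_two_of_mem_admissibleClass hf).toLp f = v}
  have hanti : Antitone K := by
    rintro m n hmn _ ⟨f, hf, hfC, rfl⟩
    refine ⟨f, hf, le_trans ?_ hfC, rfl⟩
    have : (1 : ℝ) / ((n : ℝ) + 1) ≤ 1 / ((m : ℝ) + 1) := by gcongr
    linarith
  have hne : ∀ n, (K n).Nonempty := fun n =>
    let ⟨f, hf, hfC⟩ := hC (1 / ((n : ℝ) + 1)) Nat.one_div_pos_of_nat
    ⟨_, f, hf, hfC.le, rfl⟩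
  have hconv : ∀ n, Convex ℝ (K n) := by
    rintro n _ ⟨f, hf, hfC, rfl⟩ _ ⟨g, hg, hgC, rfl⟩ a b ha hb hab
    refine ⟨_, convex_combination_mem_admissibleClass hf hg ha hb hab, ?_, rfl⟩
    rw [integral_add (hf.2.1.const_mul a) (hg.2.1.const_mul b), integral_const_mul,
      integral_const_mul]
    calc C - 1 / ((n : ℝ) + 1)
        = a * (C - 1 / ((n : ℝ) + 1)) + b * (C - 1 / ((n : ℝ) + 1)) := by
          rw [← add_mul, hab, one_mul]
      _ ≤ _ := by gcongr
  -- Here C ≥ 0 gives ∫ f ≥ -1, whence the constant 1.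
  have hR : ∀ n, ∀ v ∈ K n, ‖v‖ ≤ Real.sqrt (2 * μ.real M + 1) := by
    rintro n _ ⟨f, hf, hfC, rfl⟩
    apply Real.le_sqrt_of_sq_le
    have h1 := norm_toLp_sq_le_of_mem_admissibleClass hf hMm hM hMfin
    have h2 : (1 : ℝ) / ((n : ℝ) + 1) ≤ 1 :=
      (div_le_one (by positivity)).mpr (by linarith [n.cast_nonneg (α := ℝ)])
    linarith
  obtain ⟨u, hu⟩ := exists_mem_iInter_closure_of_convex hanti hne hconv hR
  have hex : ∀ n : ℕ, ∃ v ∈ K n, dist u v < 1 / ((n : ℝ) + 1) := fun n =>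
    Metric.mem_closure_iff.mp (hu n) _ Nat.one_div_pos_of_nat
  choose v hvK hv using hex
  choose F hF hFC hFv using hvK
  refine ⟨u, F, hF, hFC, ?_⟩
  simp only [hFv]
  rw [tendsto_iff_dist_tendsto_zero]
  refine squeeze_zero (fun n => dist_nonneg) (fun n => ?_)
    (tendsto_one_div_add_atTop_nhds_zero_nat (𝕜 := ℝ))
  rw [dist_comm]
  exact (hv n).le

end Maximizer

/-! ### Existence of an extremal function -/

theorem mainTheorem2 {G : Type*} [AddCommGroup G] [TopologicalSpace G] [IsTopologicalAddGroup G]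
    [LocallyCompactSpace G] [T2Space G] [SigmaCompactSpace G] [MeasurableSpace G] [BorelSpace G]
    (μ : Measure G) [μ.IsAddHaarMeasure] (Ωp Ωm : Set G)
    (hp_coherent : BoundaryCoherent Ωp) (hm_coherent : BoundaryCoherent Ωm)
    (hp_symm : -Ωp = Ωp) (hm_symm : -Ωm = Ωm)
    (hp_nhds : Ωp ∈ 𝓝 (0 : G)) (hp_finite : μ Ωp < ⊤) :
    ∃ f ∈ admissibleClass μ Ωp Ωm, ((∫ x, f x ∂μ : ℝ) : EReal) = extremalValue μ Ωp Ωm := by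
  have := regular_of_isAddHaarMeasure_of_sigmaCompact μ
  -- Ωp need not be measurable; its measurable hull has the same finite measure.
  have hMm := measurableSet_toMeasurable μ Ωp
  have hM := subset_toMeasurable μ Ωp
  have hMfin : μ (toMeasurable μ Ωp) ≠ ⊤ := by rw [measure_toMeasurable]; exact hp_finite.ne
  obtain ⟨f₀, hf₀, hf₀pos⟩ := exists_mem_admissibleClass_integral_pos μ Ωm hp_nhds
  let I : Set ℝ := (fun f : G → ℝ => ∫ x, f x ∂μ) '' admissibleClass μ Ωp Ωm
  have hIne : I.Nonempty := ⟨_, f₀, hf₀, rfl⟩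
  have hIbdd : BddAbove I := by
    refine ⟨μ.real (toMeasurable μ Ωp), ?_⟩
    rintro _ ⟨f, hf, rfl⟩
    exact integral_le_of_mem_admissibleClass hf hMm hM hMfin
  obtain ⟨C, hCdef⟩ : ∃ C, C = sSup I := ⟨_, rfl⟩
  have hCub : ∀ f ∈ admissibleClass μ Ωp Ωm, ∫ x, f x ∂μ ≤ C := fun f hf =>
    hCdef ▸ le_csSup hIbdd ⟨f, hf, rfl⟩
  have hCpos : 0 < C := hf₀pos.trans_le (hCub f₀ hf₀)
  have hCapprox : ∀ ε > 0, ∃ f ∈ admissibleClass μ Ωp Ωm, C - ε < ∫ x, f x ∂μ := by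
    intro ε hε
    obtain ⟨_, ⟨f, hf, rfl⟩, hlt⟩ :=
      exists_lt_of_lt_csSup hIne (show C - ε < sSup I by rw [← hCdef]; linarith)
    exact ⟨f, hf, hlt⟩
  obtain ⟨u, F, hF, hFC, hFu⟩ := exists_maximizing_seq_tendsto_Lp hCpos.le hCapprox hMm hM hMfin
  obtain ⟨h, hhc, hhpd, hh1, hhu⟩ := exists_continuous_positiveDefinite_ae_eq u fun ε hε => by
    obtain ⟨n, hn⟩ := (Metric.tendsto_nhds.mp hFu ε hε).exists
    rw [dist_eq_norm] at hn
    exact ⟨F n, ⟨(hF n).1.1, (hF n).1.2.1, _, hn⟩, (hF n).1.2.2.le⟩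
  obtain ⟨ns, hns, hae⟩ := (tendstoInMeasure_of_tendsto_Lp hFu).exists_seq_tendsto_ae
  have hlim : ∀ᵐ x ∂μ, Filter.Tendsto (fun k => F (ns k) x) Filter.atTop (𝓝 (h x)) := by
    have hco : ∀ᵐ x ∂μ, ∀ n, (memLp_two_of_mem_admissibleClass (hF n)).toLp (F n) x = F n x :=
      ae_all_iff.mpr fun n => (memLp_two_of_mem_admissibleClass (hF n)).coeFn_toLp
    filter_upwards [hae, hco, hhu] with x hx hx' hx''
    simp only [hx'] at hx
    rwa [hx'']
  have hcC : Filter.Tendsto (fun k => C - 1 / ((ns k : ℝ) + 1)) Filter.atTop (𝓝 C) := by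
    have := ((tendsto_one_div_add_atTop_nhds_zero_nat (𝕜 := ℝ)).comp hns.tendsto_atTop).const_sub C
    simpa using this
  obtain ⟨hhint, hCh⟩ := integrable_and_le_integral_of_tendsto_admissibleClass
    (fun k => hF (ns k)) (Lp.aestronglyMeasurable u |>.congr hhu.symm) hlim hcC
    (fun k => hFC (ns k)) hMm hM hMfin
  -- If h 0 = 0 then h = 0, contradicting 0 < C ≤ ∫ h.
  have hh0 : 0 < h 0 := by
    refine lt_of_le_of_ne hhpd.zero_nonneg fun h0 => ?_
    have hz : h = 0 := funext fun x => abs_nonpos_iff.mp (h0 ▸ hhpd.abs_le x)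
    simp [hz] at hCh
    linarith
  have hp : ∀ x, x ∉ Ωp → h x ≤ 0 := fun x hx => by
    refine hp_coherent.nonpos_of_ae (μ := μ) hhc ?_ hx
    filter_upwards [hlim] with y hy hyΩ
    exact le_of_tendsto' hy fun k => nonpos_of_mem_admissibleClass (hF (ns k)) hyΩ
  have hm : ∀ x, x ∉ Ωm → 0 ≤ h x := fun x hx => by
    refine neg_nonpos.mp (hm_coherent.nonpos_of_ae (μ := μ) (h := fun x => -h x) hhc.neg ?_ hx)
    filter_upwards [hlim] with y hy hyΩ
    exact neg_nonpos.mpr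
      (ge_of_tendsto' hy fun k => nonneg_of_mem_admissibleClass (hF (ns k)) hyΩ)
  have hmem : (fun x => (h 0)⁻¹ * h x) ∈ admissibleClass μ Ωp Ωm := by
    refine ⟨⟨by fun_prop, hhpd.const_mul (by positivity), inv_mul_cancel₀ hh0.ne'⟩,
      hhint.const_mul _, fun x hx => ?_, fun x hx => ?_⟩
    · by_contra hxn
      exact (mul_nonpos_of_nonneg_of_nonpos (inv_nonneg.mpr hh0.le) (hp x hxn)).not_gt hx
    · by_contra hxn
      exact (mul_nonneg (inv_nonneg.mpr hh0.le) (hm x hxn)).not_gt hx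
  refine ⟨_, hmem, coe_integral_eq_extremalValue hmem ?_ hCub⟩
  rw [integral_const_mul]
  exact hCh.trans (le_mul_of_one_le_left (hCpos.le.trans hCh) ((one_le_inv₀ hh0).mpr hh1))
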